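/- An observable on $\mathbb{C}^3$ with outcome set $\Omega$ (finite) is a family $(A_x)_{x\in\Omega}$ of positive semidefinite complex $3\times 3$ matrices with $\sum_x A_x=\mathbb{1}$. Two observables $A,B$ commute if $A_xB_y=B_yA_x$ for all $x,y$. A state is a positive semidefinite matrix of trace $1$. An instrument implementing $A$ is a family $\mathcal{I}=(\mathcal{I}_x)_{x\in\Omega}$ of completely positive linear maps on $M_3(\mathbb{C})$ with $\mathcal{I}_x^*(\mathbb{1})=A_x$ for all $x$, where the adjoint is defined by $\operatorname{tr}(X\,\mathcal{I}_x(Y))=\operatorname{tr}(\mathcal{I}_x^*(X)\,Y)$. It does not disturb $B$ if $\operatorname{tr}\big(\sum_x\mathcal{I}_x(\varrho)B_y\big)=\operatorname{tr}(\varrho B_y)$ for all states $\varrho$ and all outcomes $y$ of $B$. We say that $A$ can be measured without disturbing $B$ if some instrument implementing $A$ does not disturb $B$. Let $$K_1=\tfrac12\begin{pmatrix}\sqrt2&0&0\\0&0&0\\-1&0&0\end{pmatrix},\quad K_2=\tfrac1{10}\begin{pmatrix}0&0&0\\0&-\sqrt{10}&0\\0&2\sqrt{10}&0\end{pmatrix},\quad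 K_3=\tfrac12\begin{pmatrix}0&0&0\\0&\sqrt2&0\\0&0&0\end{pmatrix},$$ $$K_4=\tfrac1{20}\begin{pmatrix}0&0&0\\0&4\sqrt{10}&0\\0&2\sqrt{10}&0\end{pmatrix},\quad K_5=\tfrac12\begin{pmatrix}\sqrt2&0&0\\0&0&0\\1&0&0\end{pmatrix},$$ let $A_x=K_xK_x^*$ for $x=1,\dots,5$, and let $$B_1=\tfrac12\begin{pmatrix}2&0&0\\0&0&0\\0&0&1\end{pmatrix},\quad B_2=\tfrac12\begin{pmatrix}0&0&0\\0&2&0\\0&0&1\end{pmatrix}.$$ Then: (1) $A=(A_x)_{x=1}^5$ and $B=(B_1,B_2)$ are observables, and $$A_1=\tfrac14\begin{pmatrix}2&0&-\sqrt2\\0&0&0\\-\sqrt2&0&1\end{pmatrix},\quad A_2=\tfrac1{10}\begin{pmatrix}0&0&0\\0&1&-2\\0&-2&4\end{pmatrix},\quad A_3=\tfrac12\begin{pmatrix}0&0&0\\0&1&0\\0&0&0\end{pmatrix},$$ $$A_4=\tfrac1{10}\begin{pmatrix}0&0&0\\0&4&2\\0&2&1\end{pmatrix},\quad A_5=\tfrac14\begin{pmatrix}2&0&\sqrt2\\0&0&0\\\sqrt2&0&1\end{pmatrix}.$$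 (2) There is an instrument $\mathcal{I}$ with $\mathcal{I}_x^*(X)=K_xXK_x^*$ for all $x$ and all $X\in M_3(\mathbb{C})$; it implements $A$ and does not disturb $B$. (3) $A_1,\dots,A_5$ are linearly independent over $\mathbb{C}$, and $A$ and $B$ do not commute. (4) No instrument that implements $B$ leaves $A$ undisturbed: every $B$-measurement disturbs $A$. (5) Consequently the relation "can be measured without disturbing" between observables on $\mathbb{C}^3$ is not symmetric. -/

import Mathlib

open scoped Matrix Matrix.Norms.L2Operator MatrixOrder ComplexOrder CStarAlgebra

noncomputable section

namespace QuantumMeasurement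

variable {n : Type} [Fintype n] [DecidableEq n] {Ω Ω' : Type} [Fintype Ω] [Fintype Ω']

/-- A discrete observable (POVM) on `ℂⁿ` with finitely many outcomes: positive semidefinite
matrices indexed by the outcomes and summing to the identity. -/
def IsObservable (A : Ω → Matrix n n ℂ) : Prop :=
  (∀ x, (A x).PosSemidef) ∧ ∑ x, A x = 1

/-- A state (density operator): a positive semidefinite matrix of trace one. -/
def IsState (ρ : Matrix n n ℂ) : Prop :=
  ρ.PosSemidef ∧ ρ.trace = 1

/-- Two observables commute if all their effects commute. -/
def ObservablesCommute (A : Ω → Matrix n n ℂ) (B : Ω' → Matrix n n ℂ) : Prop :=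
  ∀ x y, A x * B y = B y * A x

/-- The adjoint (Heisenberg picture) `φ*` of a linear map `φ` on matrices with respect to the
trace duality; its entries are `φ*(X) i j = tr (X φ(E_{ji}))`. It is characterised by
`trace_mul_apply` and `eq_heisenberg` below. -/
def heisenberg (φ : Matrix n n ℂ →ₗ[ℂ] Matrix n n ℂ) (X : Matrix n n ℂ) : Matrix n n ℂ :=
  Matrix.of fun i j => (X * φ (Matrix.single j i 1)).trace

/-- The defining property of the adjoint map: `tr (X φ(Y)) = tr (φ*(X) Y)`. -/
theorem trace_mul_apply (φ : Matrix n n ℂ →ₗ[ℂ] Matrix n n ℂ) (X Y : Matrix n n ℂ) :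
    (X * φ Y).trace = (heisenberg φ X * Y).trace := by
  conv_lhs => rw [Matrix.matrix_eq_sum_single Y]
  have h : ∀ i j, Matrix.single i j (Y i j) = Y i j • Matrix.single i j (1 : ℂ) := by
    intro i j; simp [Matrix.smul_single]
  simp only [h, map_sum, map_smul, Matrix.mul_sum, Matrix.trace_sum, Matrix.mul_smul,
    Matrix.trace_smul]
  rw [Finset.sum_comm]
  simp only [Matrix.trace, Matrix.diag_apply, Matrix.mul_apply, heisenberg, Matrix.of_apply,
    smul_eq_mul]
  exact Finset.sum_congr rfl fun i _ => Finset.sum_congr rfl fun j _ => mul_comm _ _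

/-- The adjoint map is the only map with that property. -/
theorem eq_heisenberg (φ : Matrix n n ℂ →ₗ[ℂ] Matrix n n ℂ) (ψ : Matrix n n ℂ → Matrix n n ℂ)
    (h : ∀ X Y, (X * φ Y).trace = (ψ X * Y).trace) : ψ = heisenberg φ := by
  funext X
  ext i j
  simp [heisenberg, h, Matrix.trace_mul_single]

/-- An instrument in the Schrödinger picture: one completely positive linear map for each outcome.
(That the maps sum up to a trace preserving one is part of `Implements`, for an observable.) -/
abbrev Instrument (Ω n : Type) [Fintype n] [DecidableEq n] : Type :=
  Ω → (Matrix n n ℂ →CP Matrix n n ℂ)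

/-- The instrument `I` implements `A`: `I_x*(1) = A_x` for every outcome `x`. -/
def Instrument.Implements (I : Instrument Ω n) (A : Ω → Matrix n n ℂ) : Prop :=
  ∀ x, heisenberg (I x).toLinearMap 1 = A x

/-- The instrument `I` does not disturb `B`: the unconditional output state `∑ x, I_x(ρ)` has the
same `B`-statistics as the input state `ρ`, for every state `ρ`. -/
def Instrument.NotDisturbs (I : Instrument Ω n) (B : Ω' → Matrix n n ℂ) : Prop :=
  ∀ ρ : Matrix n n ℂ, IsState ρ → ∀ y, ((∑ x, I x ρ) * B y).trace = (ρ * B y).trace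

/-- `A` can be measured without disturbing `B`. -/
def MeasurableWithoutDisturbing (A : Ω → Matrix n n ℂ) (B : Ω' → Matrix n n ℂ) : Prop :=
  ∃ I : Instrument Ω n, I.Implements A ∧ I.NotDisturbs B

/-- The five operators `K_1, …, K_5` on `ℂ³` (with indices shifted to `0, …, 4`). -/
def exK : Fin 5 → Matrix (Fin 3) (Fin 3) ℂ :=
  ![(1 / 2 : ℂ) • !![((√2 : ℝ) : ℂ), 0, 0; 0, 0, 0; -1, 0, 0],
    (1 / 10 : ℂ) • !![0, 0, 0; 0, -((√10 : ℝ) : ℂ), 0; 0, 2 * ((√10 : ℝ) : ℂ), 0],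
    (1 / 2 : ℂ) • !![0, 0, 0; 0, ((√2 : ℝ) : ℂ), 0; 0, 0, 0],
    (1 / 20 : ℂ) • !![0, 0, 0; 0, 4 * ((√10 : ℝ) : ℂ), 0; 0, 2 * ((√10 : ℝ) : ℂ), 0],
    (1 / 2 : ℂ) • !![((√2 : ℝ) : ℂ), 0, 0; 0, 0, 0; 1, 0, 0]]

/-- The five-outcome observable `A_x = K_x K_x*`. -/
def exA (x : Fin 5) : Matrix (Fin 3) (Fin 3) ℂ :=
  exK x * (exK x)ᴴ

/-- The two-outcome observable `B`. -/
def exB : Fin 2 → Matrix (Fin 3) (Fin 3) ℂ :=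
  ![(1 / 2 : ℂ) • !![2, 0, 0; 0, 0, 0; 0, 0, 1],
    (1 / 2 : ℂ) • !![0, 0, 0; 0, 2, 0; 0, 0, 1]]

end QuantumMeasurement

end

/-!
An instrument with one Kraus operator per outcome, `X ↦ K_x X K_x*` in the Heisenberg picture,
implements `A_x = K_x K_x*`. Every `K_x` of the example has a single nonzero column, so
`K_x B_y K_x*` is a multiple of `A_x`, with the corresponding diagonal entry of `B_y` as the factor.
Since `A_0 + A_4 = diag(1, 0, 1/2) = B_0` and `A_1 + A_2 + A_3 = diag(0, 1, 1/2) = B_1`, these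
multiples add up to `B_y`, and `B` is not disturbed (`exI_notDisturbs`).

In the other direction, the linear span of the effects of `A` contains the matrix units `E_{00}`,
`E_{11}`, `E_{22}` and the coherence `E_{02} + E_{20}`. Let `Φ` be the total channel of an
instrument `J` that leaves `A` undisturbed; it then preserves the statistics of these four
matrices. The Choi matrix of each `J_x` is positive semidefinite (`choi_posSemidef`). As `Φ`
preserves populations, the diagonal entries of all these Choi matrices vanish outside the indices
`(i, i)`, hence so do the corresponding rows and columns. As `Φ` preserves the coherence, the
quadratic form of the total Choi matrix vanishes at `e_0 ⊗ e_0 - e_2 ⊗ e_2`; by positivity every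
single Choi matrix annihilates this vector, which forces its two relevant diagonal entries to
coincide. Those entries are the `(0, 0)` and `(2, 2)` entries of the implemented effect
(`heisenberg_one_diag_eq`). For `B_0 = diag(1, 0, 1/2)` they differ, so no instrument implementing
`B` leaves `A` undisturbed.
-/

namespace QuantumMeasurement

variable {n : Type} [Fintype n] [DecidableEq n] {Ω : Type} [Fintype Ω]

/-! ### Completely positive maps on matrices -/

/-- Stated for an abstract C⋆-algebra, so that it applies to `CStarMatrix`, for which the
instances required by the continuous functional calculus are not found directly. -/
theorem exists_eq_star_mul_self {A : Type*} [NonUnitalCStarAlgebra A] [PartialOrder A]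
    [StarOrderedRing A] {a : A} (ha : 0 ≤ a) : ∃ b, a = star b * b :=
  CStarAlgebra.nonneg_iff_eq_star_mul_self.mp ha

/-- The completely positive map `X ↦ L* X L` with the single Kraus operator `L*`. -/
noncomputable def conjCP (L : Matrix n n ℂ) : Matrix n n ℂ →CP Matrix n n ℂ where
  toFun X := Lᴴ * X * L
  map_add' X Y := by rw [mul_add, add_mul]
  map_smul' c X := by simp
  map_cstarMatrix_nonneg' k M hM := by
    obtain ⟨N, rfl⟩ := exists_eq_star_mul_self hM
    have h : (star N * N).map (fun X => Lᴴ * X * L) =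
        star (N.map (· * L)) * N.map (· * L) := by
      ext1 i j
      simp [CStarMatrix.mul_apply, CStarMatrix.star_apply, Matrix.mul_sum, Matrix.sum_mul,
        Matrix.star_eq_conjTranspose, Matrix.conjTranspose_mul, Matrix.mul_assoc]
    change 0 ≤ (star N * N).map (fun X => Lᴴ * X * L)
    rw [h]
    exact star_mul_self_nonneg _

theorem conjCP_apply (L X : Matrix n n ℂ) : conjCP L X = Lᴴ * X * L := rfl

/-- The Heisenberg picture of `X ↦ L* X L` is `X ↦ L X L*`. -/
theorem heisenberg_conjCP (L X : Matrix n n ℂ) :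
    heisenberg (conjCP L).toLinearMap X = L * X * Lᴴ := by
  refine (congrFun (eq_heisenberg (conjCP L).toLinearMap (fun X => L * X * Lᴴ) ?_) X).symm
  intro X Y
  change (X * (Lᴴ * Y * L)).trace = _
  rw [← Matrix.mul_assoc, Matrix.trace_mul_comm]
  simp only [Matrix.mul_assoc]

/-- The Choi matrix of `φ`, indexed by pairs: its block at `(i, j)` is `φ(E_{ij})`. -/
def choi (φ : Matrix n n ℂ → Matrix n n ℂ) : Matrix (n × n) (n × n) ℂ :=
  Matrix.of fun p q => φ (Matrix.single p.1 q.1 1) p.2 q.2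

theorem choi_apply {m : Type} [DecidableEq m] (φ : Matrix m m ℂ → Matrix m m ℂ) (i j k l : m) :
    choi φ (i, k) (j, l) = φ (Matrix.single i j 1) k l := rfl

/-- The block matrix `(E_{ij})` is positive, being `V* V` for the block matrix `V` whose only
nonzero row is `(E_{aj})_j`; hence a completely positive map has a positive Choi matrix. -/
theorem choi_posSemidef (φ : Matrix n n ℂ →CP Matrix n n ℂ) : (choi φ).PosSemidef := by
  rcases isEmpty_or_nonempty n with _ | ⟨⟨a⟩⟩
  · rw [Subsingleton.elim (choi φ) 0]
    exact Matrix.PosSemidef.zero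
  let V : CStarMatrix n n (Matrix n n ℂ) :=
    CStarMatrix.ofMatrix fun k j => if k = a then Matrix.single a j 1 else 0
  have hV : ∀ i j, (star V * V) i j = Matrix.single i j 1 := by
    intro i j
    rw [CStarMatrix.mul_apply, Finset.sum_eq_single a]
    · rw [CStarMatrix.star_apply]
      change star (if a = a then Matrix.single a i (1 : ℂ) else 0) *
        (if a = a then Matrix.single a j (1 : ℂ) else 0) = _
      simp [Matrix.star_eq_conjTranspose]
    · intro k _ hk
      change _ * (if k = a then Matrix.single a j (1 : ℂ) else 0) = 0
      rw [if_neg hk, mul_zero]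
    · simp
  obtain ⟨N, hN⟩ := exists_eq_star_mul_self
    (φ.map_cstarMatrix_nonneg _ (star_mul_self_nonneg V))
  have h : choi φ = (Matrix.of fun (p q : n × n) => N p.1 q.1 p.2 q.2)ᴴ *
      Matrix.of fun (p q : n × n) => N p.1 q.1 p.2 q.2 := by
    ext ⟨i, k⟩ ⟨j, l⟩
    have hij := congrFun (congrFun (CStarMatrix.ext_iff.mpr hN i j) k) l
    rw [CStarMatrix.map_apply, hV, CStarMatrix.mul_apply] at hij
    rw [choi_apply, hij]
    simp [Matrix.sum_apply, Matrix.mul_apply, CStarMatrix.star_apply, Fintype.sum_prod_type]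
  rw [h]
  exact Matrix.posSemidef_conjTranspose_mul_self _

theorem apply_eq_zero_of_diag_eq_zero {m : Type*} [Fintype m] [DecidableEq m]
    {M : Matrix m m ℂ} (hM : M.PosSemidef) {i : m} (hi : M i i = 0) (j : m) :
    M i j = 0 ∧ M j i = 0 := by
  have h : M *ᵥ Pi.single i 1 = 0 :=
    (hM.dotProduct_mulVec_zero_iff _).mp (by simpa [← Pi.single_star] using hi)
  have hj : M j i = 0 := by simpa using congrFun h j
  exact ⟨by rw [← hM.1.apply, hj, star_zero], hj⟩

/-! ### Instruments preserving populations and a coherence -/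

theorem isState_single (i : n) : IsState (Matrix.single i i (1 : ℂ)) := by
  refine ⟨?_, by simp⟩
  have h := Matrix.posSemidef_vecMulVec_self_star (Pi.single i (1 : ℂ) : n → ℂ)
  rwa [← Pi.single_star, star_one, ← Matrix.single_eq_single_vecMulVec_single] at h

/-- The pure state of the vector `(e_i + e_j) / √2`. -/
theorem isState_superposition {i j : n} (hij : i ≠ j) :
    IsState ((1 / 2 : ℂ) • (Matrix.single i i 1 + Matrix.single i j 1 +
      (Matrix.single j i 1 + Matrix.single j j 1)) : Matrix n n ℂ) := by
  constructor
  · have h := Matrix.posSemidef_vecMulVec_self_star (Pi.single i 1 + Pi.single j 1 : n → ℂ)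
    rw [star_add, ← Pi.single_star, ← Pi.single_star, star_one, Matrix.add_vecMulVec,
      Matrix.vecMulVec_add, Matrix.vecMulVec_add] at h
    simp only [← Matrix.single_eq_single_vecMulVec_single] at h
    exact h.smul (by norm_num [Complex.le_def])
  · simp [Matrix.trace_single_eq_of_ne, hij, hij.symm]
    norm_num

/-- The rigidity behind the disturbance: if the total channel of an instrument preserves the
populations of all basis vectors and the coherence `ρ i j + ρ j i`, then none of the implemented
effects distinguishes `e_i` from `e_j`. -/
theorem heisenberg_one_diag_eq (J : Instrument Ω n) {i j : n} (hij : i ≠ j)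
    (hdiag : ∀ ρ, IsState ρ → ∀ k, (∑ x, J x ρ) k k = ρ k k)
    (hoff : ∀ ρ, IsState ρ → (∑ x, J x ρ) i j + (∑ x, J x ρ) j i = ρ i j + ρ j i) (x : Ω) :
    heisenberg (J x).toLinearMap 1 i i = heisenberg (J x).toLinearMap 1 j j := by
  have hpos := fun x => choi_posSemidef (J x)
  -- Populations are preserved, so the off-support diagonal entries of each Choi matrix vanish.
  have hzero : ∀ x a k, k ≠ a → choi (J x) (a, k) (a, k) = 0 := by
    intro x a k hk
    have hsum : ∑ x, choi (J x) (a, k) (a, k) = 0 := by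
      have := hdiag _ (isState_single a) k
      rw [Matrix.sum_apply, Matrix.single_apply_of_row_ne hk.symm] at this
      exact this
    exact (Finset.sum_eq_zero_iff_of_nonneg fun x _ => (hpos x).diag_nonneg).mp hsum x
      (Finset.mem_univ x)
  have hrow : ∀ x a k, k ≠ a → ∀ p, choi (J x) (a, k) p = 0 ∧ choi (J x) p (a, k) = 0 :=
    fun x a k hk => apply_eq_zero_of_diag_eq_zero (hpos x) (hzero x a k hk)
  have hone : ∀ a, ∑ x, choi (J x) (a, a) (a, a) = 1 := by
    intro a
    have := hdiag _ (isState_single a) a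
    rw [Matrix.sum_apply, Matrix.single_apply_same] at this
    exact this
  have hcoh : ∑ x, (choi (J x) (i, i) (j, j) + choi (J x) (j, j) (i, i)) = 2 := by
    have h := hoff _ (isState_superposition hij)
    rw [Matrix.sum_apply, Matrix.sum_apply, ← Finset.sum_add_distrib] at h
    have hx : ∀ x, choi (J x) (i, i) (j, j) + choi (J x) (j, j) (i, i) =
        2 * ((J x ((1 / 2 : ℂ) • (Matrix.single i i 1 + Matrix.single i j 1 +
          (Matrix.single j i 1 + Matrix.single j j 1)))) i j +
        (J x ((1 / 2 : ℂ) • (Matrix.single i i 1 + Matrix.single i j 1 +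
          (Matrix.single j i 1 + Matrix.single j j 1)))) j i) := by
      intro x
      simp only [map_smul, map_add, Matrix.smul_apply, Matrix.add_apply, ← choi_apply,
        (hrow x i j hij.symm _).1, (hrow x i j hij.symm _).2, (hrow x j i hij _).1,
        (hrow x j i hij _).2, smul_eq_mul]
      ring
    rw [Finset.sum_congr rfl fun x _ => hx x, ← Finset.mul_sum, h]
    simp [hij, hij.symm]
    norm_num
  -- The vector `e_i ⊗ e_i - e_j ⊗ e_j` is annihilated by the total Choi matrix, hence by each.
  let w : n × n → ℂ := Pi.single (i, i) 1 - Pi.single (j, j) 1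
  have hw : ∀ x, star w ⬝ᵥ choi (J x) *ᵥ w = choi (J x) (i, i) (i, i) +
      choi (J x) (j, j) (j, j) - (choi (J x) (i, i) (j, j) + choi (J x) (j, j) (i, i)) := by
    intro x
    simp [w, star_sub, Matrix.mulVec_sub, sub_dotProduct]
    ring
  have hwsum : ∑ x, star w ⬝ᵥ choi (J x) *ᵥ w = 0 := by
    simp only [hw]
    rw [Finset.sum_sub_distrib, Finset.sum_add_distrib, hone, hone, hcoh]
    norm_num
  have hker : choi (J x) *ᵥ w = 0 :=
    ((hpos x).dotProduct_mulVec_zero_iff w).mp <|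
      (Finset.sum_eq_zero_iff_of_nonneg fun x _ => (hpos x).dotProduct_mulVec_nonneg w).mp
        hwsum x (Finset.mem_univ x)
  have hrowker : ∀ p, choi (J x) p (i, i) = choi (J x) p (j, j) := by
    intro p
    have := congrFun hker p
    simpa [w, Matrix.mulVec_sub, sub_eq_zero] using this
  have heis : ∀ a, heisenberg (J x).toLinearMap 1 a a = choi (J x) (a, a) (a, a) := by
    intro a
    change (1 * J x (Matrix.single a a 1)).trace = _
    rw [one_mul, Matrix.trace]
    exact Finset.sum_eq_single a (fun k _ hk => hzero x a k hk)
      fun h => absurd (Finset.mem_univ a) h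
  rw [heis, heis, hrowker, ← (hpos x).1.apply, hrowker, (hpos x).1.apply]

/-! ### The observables `A` and `B` -/

theorem ofReal_sqrt_mul_self {r : ℝ} (hr : 0 ≤ r) : ((√r : ℝ) : ℂ) * ((√r : ℝ) : ℂ) = r := by
  rw [← Complex.ofReal_mul, Real.mul_self_sqrt hr]

theorem sqrt_two_mul_self : ((√2 : ℝ) : ℂ) * ((√2 : ℝ) : ℂ) = 2 := by
  simpa using ofReal_sqrt_mul_self (r := 2) (by norm_num)

theorem sqrt_ten_mul_self : ((√10 : ℝ) : ℂ) * ((√10 : ℝ) : ℂ) = 10 := by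
  simpa using ofReal_sqrt_mul_self (r := 10) (by norm_num)

theorem exK_conjTranspose (x : Fin 5) : (exK x)ᴴ = (exK x)ᵀ := by
  fin_cases x <;> ext i j <;> fin_cases i <;> fin_cases j <;> simp [exK]

theorem exA_eq : exA =
    ![(1 / 4 : ℂ) • !![2, 0, -((√2 : ℝ) : ℂ); 0, 0, 0; -((√2 : ℝ) : ℂ), 0, 1],
      (1 / 10 : ℂ) • !![0, 0, 0; 0, 1, -2; 0, -2, 4],
      (1 / 2 : ℂ) • !![0, 0, 0; 0, 1, 0; 0, 0, 0],
      (1 / 10 : ℂ) • !![0, 0, 0; 0, 4, 2; 0, 2, 1],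
      (1 / 4 : ℂ) • !![2, 0, ((√2 : ℝ) : ℂ); 0, 0, 0; ((√2 : ℝ) : ℂ), 0, 1]] := by
  have h2 := sqrt_two_mul_self
  have h10 := sqrt_ten_mul_self
  funext x
  rw [exA, exK_conjTranspose]
  fin_cases x <;> ext i j <;> fin_cases i <;> fin_cases j <;>
    simp [exK, Matrix.mul_apply, Fin.sum_univ_three] <;> grind

theorem isObservable_exA : IsObservable exA := by
  refine ⟨fun x => Matrix.posSemidef_self_mul_conjTranspose _, ?_⟩
  rw [exA_eq]
  ext i j
  fin_cases i <;> fin_cases j <;> simp [Fin.sum_univ_five] <;> norm_num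

theorem isObservable_exB : IsObservable exB := by
  constructor
  · have hdiag : ∀ y, exB y = Matrix.diagonal (![![1, 0, 1 / 2], ![0, 1, 1 / 2]] y) := by
      intro y
      fin_cases y <;> ext i j <;> fin_cases i <;> fin_cases j <;> simp [exB]
    intro y
    rw [hdiag]
    refine Matrix.PosSemidef.diagonal fun i => ?_
    fin_cases y <;> fin_cases i <;> simp
  · ext i j
    fin_cases i <;> fin_cases j <;> simp [exB, Fin.sum_univ_two]
    norm_num

/-- The instrument whose `x`-th operation has the Heisenberg picture `X ↦ K_x X K_x*`. -/
noncomputable def exI : Instrument (Fin 5) (Fin 3) := fun x => conjCP (exK x)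

theorem heisenberg_exI (x : Fin 5) (X : Matrix (Fin 3) (Fin 3) ℂ) :
    heisenberg (exI x).toLinearMap X = exK x * X * (exK x)ᴴ :=
  heisenberg_conjCP _ _

theorem exI_implements : exI.Implements exA := by
  intro x
  rw [heisenberg_exI, mul_one, exA]

theorem mul_mul_conjTranspose_of_mul_single {n : Type} [Fintype n] [DecidableEq n]
    {K : Matrix n n ℂ} {s : n} (hK : K * Matrix.single s s 1 = K) (X : Matrix n n ℂ) :
    K * X * Kᴴ = X s s • (K * Kᴴ) := by
  have hKs : Matrix.single s s 1 * Kᴴ = Kᴴ := by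
    simpa using congrArg Matrix.conjTranspose hK
  calc K * X * Kᴴ = K * Matrix.single s s 1 * X * (Matrix.single s s 1 * Kᴴ) := by rw [hK, hKs]
    _ = K * (Matrix.single s s 1 * X * Matrix.single s s 1) * Kᴴ := by simp only [Matrix.mul_assoc]
    _ = X s s • (K * Matrix.single s s 1 * Kᴴ) := by
      have hX : Matrix.single s s (X s s) = X s s • Matrix.single s s (1 : ℂ) := by
        simp [Matrix.smul_single]
      rw [Matrix.single_mul_mul_single, one_mul, mul_one, hX, Matrix.mul_smul, Matrix.smul_mul]
    _ = X s s • (K * Kᴴ) := by rw [hK]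

/-- Each `K_x` has a single nonzero column, the zeroth for `x = 0, 4` and the first otherwise, so
`K_x B_y K_x*` is a multiple of `A_x`. -/
theorem exK_mul_mul_conjTranspose (x : Fin 5) (X : Matrix (Fin 3) (Fin 3) ℂ) :
    exK x * X * (exK x)ᴴ =
      X (![0, 1, 1, 1, 0] x) (![0, 1, 1, 1, 0] x) • exA x := by
  refine mul_mul_conjTranspose_of_mul_single ?_ X
  fin_cases x <;> ext i j <;> fin_cases i <;> fin_cases j <;>
    simp [exK, Matrix.mul_apply, Matrix.single_apply]

theorem sum_exK_mul_exB_mul (y : Fin 2) : ∑ x, exK x * exB y * (exK x)ᴴ = exB y := by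
  simp only [exK_mul_mul_conjTranspose]
  rw [exA_eq]
  fin_cases y <;> ext i j <;> fin_cases i <;> fin_cases j <;>
    simp [exB, Fin.sum_univ_five] <;> norm_num

theorem exI_notDisturbs : exI.NotDisturbs exB := by
  intro ρ _ y
  have h : ∀ x, (exB y * exI x ρ).trace = (exK x * exB y * (exK x)ᴴ * ρ).trace := by
    intro x
    rw [← heisenberg_exI, ← trace_mul_apply]
    rfl
  rw [Matrix.trace_mul_comm, Matrix.mul_sum, Matrix.trace_sum, Finset.sum_congr rfl fun x _ => h x,
    ← Matrix.trace_sum, ← Matrix.sum_mul, sum_exK_mul_exB_mul, Matrix.trace_mul_comm]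

theorem linearIndependent_exA : LinearIndependent ℂ exA := by
  rw [Fintype.linearIndependent_iff]
  intro g hg
  rw [exA_eq] at hg
  have e := fun i j => congrFun (congrFun hg i) j
  have h00 := e 0 0
  have h02 := e 0 2
  have h11 := e 1 1
  have h12 := e 1 2
  have h22 := e 2 2
  simp [Fin.sum_univ_five] at h00 h02 h11 h12 h22
  have h2 := sqrt_two_mul_self
  have g0 : g 0 = 0 := by
    linear_combination h00 - ((√2 : ℝ) : ℂ) * h02 + (g 4 - g 0) / 4 * h2
  have g4 : g 4 = 0 := by linear_combination 2 * h00 - g0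
  have g3 : g 3 = 0 := by linear_combination 2 * h22 - h00 + 4 * h12
  have g1 : g 1 = 0 := by linear_combination -5 * h12 + g3
  have g2 : g 2 = 0 := by linear_combination 2 * h11 - (1 / 5) * g1 - (4 / 5) * g3
  intro x
  fin_cases x <;> assumption

theorem not_observablesCommute_exA_exB : ¬ ObservablesCommute exA exB := by
  intro h
  have := congrFun (congrFun (h 1 0) 1) 2
  rw [exA_eq] at this
  simp [exB, Matrix.mul_apply, Fin.sum_univ_three] at this

/-- The matrix units `E_{00}`, `E_{11}`, `E_{22}` and the coherence `E_{02} + E_{20}` are linear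
combinations of the effects of `A`, so an instrument that leaves `A` undisturbed cannot implement
an observable telling `e_0` from `e_2`; but the effect `B_0` has probability `1` in the first state
and `1/2` in the second. -/
theorem not_notDisturbs_exA_of_implements_exB (J : Instrument (Fin 2) (Fin 3))
    (hJ : J.Implements exB) : ¬ J.NotDisturbs exA := by
  intro hA
  -- `E_{00} = A_0 + A_4 - A_1 - A_3 + A_2`, `E_{11} = 2 A_2`, `E_{22} = 2 (A_1 + A_3 - A_2)` and
  -- `E_{02} + E_{20} = √2 (A_4 - A_0)`.
  have key : ∀ ρ, IsState ρ → (∀ k, (∑ x, J x ρ) k k = ρ k k) ∧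
      (∑ x, J x ρ) 0 2 + (∑ x, J x ρ) 2 0 = ρ 0 2 + ρ 2 0 := by
    intro ρ hρ
    have h := hA ρ hρ
    generalize ∑ x, J x ρ = S at h
    rw [exA_eq] at h
    have h0 := h 0
    have h1 := h 1
    have h2 := h 2
    have h3 := h 3
    have h4 := h 4
    simp [Matrix.trace_fin_three, Matrix.mul_apply, Fin.sum_univ_three] at h0 h1 h2 h3 h4
    have hs := sqrt_two_mul_self
    refine ⟨fun k => ?_, ?_⟩
    · fin_cases k
      · change S 0 0 = ρ 0 0
        linear_combination h0 + h4 - h1 - h3 + (1 / 2) * h2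
      · change S 1 1 = ρ 1 1
        exact h2
      · change S 2 2 = ρ 2 2
        linear_combination 2 * h1 + 2 * h3 - h2
    · linear_combination ((√2 : ℝ) : ℂ) * (h4 - h0) -
        (1 / 2) * (S 0 2 + S 2 0 - ρ 0 2 - ρ 2 0) * hs
  have h := heisenberg_one_diag_eq J (show (0 : Fin 3) ≠ 2 by decide)
    (fun ρ hρ => (key ρ hρ).1) (fun ρ hρ => (key ρ hρ).2) 0
  rw [hJ 0] at h
  simp [exB] at h

end QuantumMeasurement

theorem mainTheorem8 :
    -- `A` and `B` are observables, and the effects of `A` are the displayed matrices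
    QuantumMeasurement.IsObservable QuantumMeasurement.exA ∧
    QuantumMeasurement.IsObservable QuantumMeasurement.exB ∧
    QuantumMeasurement.exA =
      ![(1 / 4 : ℂ) • !![2, 0, -((√2 : ℝ) : ℂ); 0, 0, 0; -((√2 : ℝ) : ℂ), 0, 1],
        (1 / 10 : ℂ) • !![0, 0, 0; 0, 1, -2; 0, -2, 4],
        (1 / 2 : ℂ) • !![0, 0, 0; 0, 1, 0; 0, 0, 0],
        (1 / 10 : ℂ) • !![0, 0, 0; 0, 4, 2; 0, 2, 1],
        (1 / 4 : ℂ) • !![2, 0, ((√2 : ℝ) : ℂ); 0, 0, 0; ((√2 : ℝ) : ℂ), 0, 1]] ∧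
    -- the maps `X ↦ K_x X K_x*` are the Heisenberg picture of an instrument that implements `A`
    -- and does not disturb `B`
    (∃ I : QuantumMeasurement.Instrument (Fin 5) (Fin 3),
      (∀ x X, QuantumMeasurement.heisenberg (I x).toLinearMap X =
        QuantumMeasurement.exK x * X * (QuantumMeasurement.exK x)ᴴ) ∧
      I.Implements QuantumMeasurement.exA ∧
      I.NotDisturbs QuantumMeasurement.exB) ∧
    -- the effects of `A` are linearly independent, and `A` and `B` do not commute
    LinearIndependent ℂ QuantumMeasurement.exA ∧
    ¬ QuantumMeasurement.ObservablesCommute QuantumMeasurement.exA QuantumMeasurement.exB ∧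
    -- every `B`-measurement disturbs `A`
    (∀ J : QuantumMeasurement.Instrument (Fin 2) (Fin 3),
      J.Implements QuantumMeasurement.exB → ¬ J.NotDisturbs QuantumMeasurement.exA) ∧
    -- hence non-disturbance is not a symmetric relation between observables on `ℂ³`
    ¬ (∀ (k l : ℕ) (A : Fin k → Matrix (Fin 3) (Fin 3) ℂ) (B : Fin l → Matrix (Fin 3) (Fin 3) ℂ),
      QuantumMeasurement.IsObservable A → QuantumMeasurement.IsObservable B →
      QuantumMeasurement.MeasurableWithoutDisturbing A B →
      QuantumMeasurement.MeasurableWithoutDisturbing B A) := by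
  open QuantumMeasurement in
  refine ⟨isObservable_exA, isObservable_exB, exA_eq,
    ⟨exI, heisenberg_exI, exI_implements, exI_notDisturbs⟩, linearIndependent_exA,
    not_observablesCommute_exA_exB, not_notDisturbs_exA_of_implements_exB, fun hsymm => ?_⟩
  obtain ⟨J, hJ, hA⟩ := hsymm 5 2 exA exB isObservable_exA isObservable_exB
    ⟨exI, exI_implements, exI_notDisturbs⟩
  exact not_notDisturbs_exA_of_implements_exB J hJ hA
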